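/- **Lemma (semistability of Gauss maps).** Let $X$ be a Euclidean building or a symmetric space of noncompact type. Here a *Hadamard space* is a complete geodesic metric space of curvature $\le 0$ in the sense of global triangle comparison (a $CAT(0)$ space). A *Euclidean building* is a Hadamard space together with a maximal atlas of isometric embeddings (charts) $E\hookrightarrow X$, where $(E,W_{aff})$ is a Euclidean Coxeter complex (a finite-dimensional Euclidean space with a group of isometries $W_{aff}$ generated by hyperplane reflections and having finite linear part), such that coordinate changes between charts are restrictions of elements of $W_{aff}$ and any two points, any geodesic ray and any complete geodesic lie in the image of a chart. A *symmetric space of noncompact type* is a nonempty Riemannian symmetric space (every point is an isolated fixed point of an involutive isometry) which is complete, simply connected and of nonpositive curvature (that is, a Hadamard space), and which has no Euclidean factor, i.e. is not isometric to a product $\mathbb R\times Y$. Let $\partial_{Tits}X$ be the set of asymptoticity classes of geodesic rays in $X$, with the Tits angle $\angle_{Tits}\in[0,\pi]$ given by $$2\sin\frac{\angle_{Tits}(\xi_1,\xi_2)}2=\lim_{t\to\infty}\frac{d(\rho_1(t),\rho_2(t))}{t}$$ for unit speed rays $\rho_i$ asymptotic to $\xi_i$. Let $n\ge 1$, let $P=x_1\dots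 x_n$ be a polygon in $X$, i.e. a map $\mathbb Z/n\mathbb Z\to X$, $i\mapsto x_i$, put $m_i=d(x_{i-1},x_i)$, and let $\nu$ be the measure on $\mathbb Z/n\mathbb Z$ with $\nu(\{i\})=m_i$. Let $\psi:\mathbb Z/n\mathbb Z\to\partial_{Tits}X$, $i\mapsto\xi_i$, be any Gauss map of $P$, i.e. for every $i$ the geodesic ray from $x_{i-1}$ asymptotic to $\xi_i$ passes through $x_i$. Then the measure $\mu=\psi_*\nu=\sum_i m_i\delta_{\xi_i}$ on $\partial_{Tits}X$ is semistable: for all $\eta\in\partial_{Tits}X$, $$slope_\mu(\eta)=-\int\cos\angle_{Tits}(\xi,\eta)\,d\mu(\xi)=-\sum_{i\in\mathbb Z/n\mathbb Z}m_i\cos\angle_{Tits}(\xi_i,\eta)\ \ge\ 0 .$$ -/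

import Mathlib

open Filter Topology MeasureTheory
open scoped NNReal Manifold ContDiff Bundle

noncomputable section

universe u

/-! ### Hadamard spaces -/

/-- `σ`, restricted to `[0, 1]`, is a constant speed parametrization of a distance minimizing
geodesic segment from `x` to `y`. -/
def IsGeodesicSegment {X : Type*} [MetricSpace X] (σ : ℝ → X) (x y : X) : Prop :=
  σ 0 = x ∧ σ 1 = y ∧
    ∀ s ∈ Set.Icc (0 : ℝ) 1, ∀ t ∈ Set.Icc (0 : ℝ) 1, dist (σ s) (σ t) = |s - t| * dist x y

/-- A Hadamard space: a complete geodesic metric space in which every geodesic triangle is thinner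
than its comparison triangle in the Euclidean plane. Two points lying on two different sides
of a triangle are written as `α s` and `β t`, where `x` is the vertex shared by these sides. -/
structure IsHadamardSpace (X : Type*) [MetricSpace X] : Prop where
  complete : CompleteSpace X
  geodesic : ∀ x y : X, ∃ σ : ℝ → X, IsGeodesicSegment σ x y
  thin : ∀ (x y z : X) (α β : ℝ → X), IsGeodesicSegment α x y → IsGeodesicSegment β x z →
    ∀ x' y' z' : EuclideanSpace ℝ (Fin 2),
      dist x' y' = dist x y → dist x' z' = dist x z → dist y' z' = dist y z →
      ∀ s ∈ Set.Icc (0 : ℝ) 1, ∀ t ∈ Set.Icc (0 : ℝ) 1,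
        dist (α s) (β t) ≤ dist (AffineMap.lineMap x' y' s) (AffineMap.lineMap x' z' t)

/-! ### The boundary at infinity and the Tits angle -/

/-- A geodesic ray: an isometric embedding of `[0, ∞)`. -/
structure GeodesicRay (X : Type*) [MetricSpace X] where
  toFun : ℝ≥0 → X
  isometry : Isometry toFun

/-- Two rays are asymptotic if the distance between them is bounded. -/
def GeodesicRay.Asymptotic {X : Type*} [MetricSpace X] (ρ₁ ρ₂ : GeodesicRay X) : Prop :=
  ∃ C : ℝ, ∀ t : ℝ≥0, dist (ρ₁.toFun t) (ρ₂.toFun t) ≤ C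

/-- Asymptoticity as an equivalence relation on rays. -/
instance GeodesicRay.asymptoticSetoid (X : Type*) [MetricSpace X] : Setoid (GeodesicRay X) where
  r := GeodesicRay.Asymptotic
  iseqv := by
    refine ⟨fun ρ => ⟨0, fun t => by simp⟩, ?_, ?_⟩
    · rintro ρ₁ ρ₂ ⟨C, hC⟩
      exact ⟨C, fun t => by rw [dist_comm]; exact hC t⟩
    · rintro ρ₁ ρ₂ ρ₃ ⟨C, hC⟩ ⟨D, hD⟩
      exact ⟨C + D, fun t => (dist_triangle _ (ρ₂.toFun t) _).trans (add_le_add (hC t) (hD t))⟩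

/-- The boundary at infinity: asymptoticity classes of geodesic rays. -/
def IdealBoundary (X : Type*) [MetricSpace X] : Type _ :=
  Quotient (GeodesicRay.asymptoticSetoid X)

/-- The ideal point represented by a ray. -/
def GeodesicRay.endpoint {X : Type*} [MetricSpace X] (ρ : GeodesicRay X) : IdealBoundary X :=
  Quotient.mk (GeodesicRay.asymptoticSetoid X) ρ

/-- The linear rate of divergence `lim_{t → ∞} d(ρ₁(t), ρ₂(t)) / t` of two rays. -/
def GeodesicRay.divergence {X : Type*} [MetricSpace X] (ρ₁ ρ₂ : GeodesicRay X) : ℝ :=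
  limUnder atTop fun t : ℝ≥0 => dist (ρ₁.toFun t) (ρ₂.toFun t) / (t : ℝ)

theorem GeodesicRay.divergence_congr {X : Type*} [MetricSpace X] (ρ₁ ρ₂ ρ₁' ρ₂' : GeodesicRay X)
    (h₁ : ρ₁.Asymptotic ρ₁') (h₂ : ρ₂.Asymptotic ρ₂') :
    ρ₁.divergence ρ₂ = ρ₁'.divergence ρ₂' := by
  obtain ⟨C, hC⟩ := h₁
  obtain ⟨D, hD⟩ := h₂
  have hlim : Tendsto (fun t : ℝ≥0 => dist (ρ₁.toFun t) (ρ₂.toFun t) / (t : ℝ)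
      - dist (ρ₁'.toFun t) (ρ₂'.toFun t) / (t : ℝ)) atTop (𝓝 0) := by
    have hb : Tendsto (fun t : ℝ≥0 => (C + D) / (t : ℝ)) atTop (𝓝 0) :=
      Tendsto.div_atTop tendsto_const_nhds (NNReal.tendsto_coe_atTop.2 tendsto_id)
    refine squeeze_zero_norm (fun t => ?_) hb
    rw [← sub_div, Real.norm_eq_abs, abs_div, abs_of_nonneg (NNReal.coe_nonneg t)]
    refine div_le_div_of_nonneg_right ?_ t.2
    have := abs_dist_sub_le (ρ₁.toFun t) (ρ₁'.toFun t) (ρ₂.toFun t)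
    have h2 := abs_dist_sub_le (ρ₂.toFun t) (ρ₂'.toFun t) (ρ₁'.toFun t)
    rw [dist_comm (ρ₂.toFun t) (ρ₁'.toFun t), dist_comm (ρ₂'.toFun t) (ρ₁'.toFun t)] at h2
    have e1 := hC t
    have e2 := hD t
    rw [abs_le] at *
    constructor <;> linarith [this.1, this.2, h2.1, h2.2]
  have key : ∀ l : ℝ,
      Tendsto (fun t : ℝ≥0 => dist (ρ₁.toFun t) (ρ₂.toFun t) / (t : ℝ)) atTop (𝓝 l) ↔
      Tendsto (fun t : ℝ≥0 => dist (ρ₁'.toFun t) (ρ₂'.toFun t) / (t : ℝ)) atTop (𝓝 l) := by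
    intro l
    constructor
    · intro h
      simpa using h.sub hlim
    · intro h
      simpa using h.add hlim
  have hp : (fun l : ℝ =>
      map (fun t : ℝ≥0 => dist (ρ₁.toFun t) (ρ₂.toFun t) / (t : ℝ)) atTop ≤ 𝓝 l) =
      (fun l : ℝ =>
      map (fun t : ℝ≥0 => dist (ρ₁'.toFun t) (ρ₂'.toFun t) / (t : ℝ)) atTop ≤ 𝓝 l) :=
    funext fun l => propext (key l)
  unfold GeodesicRay.divergence limUnder lim
  rw [hp]

/-- The Tits angle, characterized by
`2 sin (∠(ξ₁, ξ₂) / 2) = lim_{t → ∞} d(ρ₁(t), ρ₂(t)) / t` and `0 ≤ ∠(ξ₁, ξ₂) ≤ π`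
for rays `ρ₁`, `ρ₂` representing `ξ₁`, `ξ₂`. In a Hadamard space this limit exists. -/
def titsAngle {X : Type*} [MetricSpace X] (ξ₁ ξ₂ : IdealBoundary X) : ℝ :=
  2 * Real.arcsin (Quotient.lift₂ GeodesicRay.divergence GeodesicRay.divergence_congr ξ₁ ξ₂ / 2)

/-! ### Euclidean buildings -/

/-- `g` is the reflection at a hyperplane of `ℝᵈ`. -/
def IsHyperplaneReflection {d : ℕ}
    (g : EuclideanSpace ℝ (Fin d) ≃ᵃⁱ[ℝ] EuclideanSpace ℝ (Fin d)) : Prop :=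
  ∃ (H : AffineSubspace ℝ (EuclideanSpace ℝ (Fin d))) (_ : Nonempty H),
    Module.finrank ℝ H.direction + 1 = d ∧ g = EuclideanGeometry.reflection H

/-- `(ℝᵈ, W)` is a Euclidean Coxeter complex: `W` is generated by reflections at hyperplanes, and
the group of linear parts of elements of `W` is finite. -/
structure IsEuclideanCoxeterComplex {d : ℕ}
    (W : Subgroup (EuclideanSpace ℝ (Fin d) ≃ᵃⁱ[ℝ] EuclideanSpace ℝ (Fin d))) : Prop where
  generated : Subgroup.closure {g | g ∈ W ∧ IsHyperplaneReflection g} = W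
  finite_linear : {r | ∃ g ∈ W, r = g.linearIsometryEquiv}.Finite

/-- A family of isometric embeddings `ℝᵈ → X` whose coordinate changes are restrictions of
elements of `W`. -/
structure IsApartmentAtlas {d : ℕ}
    (W : Subgroup (EuclideanSpace ℝ (Fin d) ≃ᵃⁱ[ℝ] EuclideanSpace ℝ (Fin d)))
    {X : Type*} [MetricSpace X] (A : Set (EuclideanSpace ℝ (Fin d) → X)) : Prop where
  isometry : ∀ f ∈ A, Isometry f
  coord_change : ∀ f ∈ A, ∀ g ∈ A, ∃ w ∈ W, ∀ p q, f p = g q → q = w p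

/-- `X` is a Euclidean building, modelled on some Euclidean Coxeter complex `(ℝᵈ, W)`, with
maximal atlas `A`. The apartments are the images of the charts in `A`. -/
def IsEuclideanBuilding (X : Type*) [MetricSpace X] : Prop :=
  IsHadamardSpace X ∧
  ∃ (d : ℕ) (W : Subgroup (EuclideanSpace ℝ (Fin d) ≃ᵃⁱ[ℝ] EuclideanSpace ℝ (Fin d)))
    (A : Set (EuclideanSpace ℝ (Fin d) → X)),
    IsEuclideanCoxeterComplex W ∧
    IsApartmentAtlas W A ∧
    (∀ A', IsApartmentAtlas W A' → A ⊆ A' → A' = A) ∧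
    (∀ x y : X, ∃ f ∈ A, x ∈ Set.range f ∧ y ∈ Set.range f) ∧
    (∀ ρ : GeodesicRay X, ∃ f ∈ A, Set.range ρ.toFun ⊆ Set.range f) ∧
    (∀ γ : ℝ → X, Isometry γ → ∃ f ∈ A, Set.range γ ⊆ Set.range f)

/-! ### Symmetric spaces of noncompact type -/

/-- The metric of `X` is the distance of some finite-dimensional smooth Riemannian manifold
structure on `X`. -/
def IsSmoothRiemannian (X : Type*) [MetricSpace X] : Prop :=
  ∃ (d : ℕ) (_ : ChartedSpace (EuclideanSpace ℝ (Fin d)) X)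
    (_ : IsManifold (𝓡 d) ∞ X)
    (_ : Bundle.RiemannianBundle (fun x : X => TangentSpace (𝓡 d) x)),
    IsContMDiffRiemannianBundle (𝓡 d) ∞ (EuclideanSpace ℝ (Fin d))
      (fun x : X => TangentSpace (𝓡 d) x) ∧
    IsRiemannianManifold (𝓡 d) X

/-- A symmetric space of noncompact type: a Riemannian manifold in which every point is an isolated
fixed point of an involutive isometry, which is complete, simply connected and of nonpositive
curvature in the (global) sense of triangle comparison, i.e. a Hadamard space, and
which has no Euclidean factor, i.e. does not split isometrically as an `ℓ²`-product `ℝ × Y`. -/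
structure IsSymmetricSpaceOfNoncompactType (X : Type u) [MetricSpace X] : Prop where
  nonempty : Nonempty X
  riemannian : IsSmoothRiemannian X
  symmetric : ∀ p : X, ∃ s : X ≃ᵢ X, s p = p ∧ (∀ q, s (s q) = q) ∧ ∀ᶠ q in 𝓝[≠] p, s q ≠ q
  nonpos_curved : IsHadamardSpace X
  no_euclidean_factor : ∀ (Y : Type u) [MetricSpace Y], IsEmpty (X ≃ᵢ WithLp 2 (ℝ × Y))

/-! ### Measures at infinity, stability and Gauss maps -/

/-- The measures on the boundary considered here are finitely supported, hence defined on all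
subsets. -/
instance IdealBoundary.instMeasurableSpace (X : Type*) [MetricSpace X] :
    MeasurableSpace (IdealBoundary X) := ⊤

/-- The slope function `slope_μ(η) = -∫ cos ∠(ξ, η) dμ(ξ)`; for `μ = ∑ mᵢ δ_{ξᵢ}` this is
`-∑ mᵢ cos ∠(ξᵢ, η)`. -/
def titsSlope {X : Type*} [MetricSpace X] (μ : Measure (IdealBoundary X)) (η : IdealBoundary X) : ℝ :=
  -∫ ξ, Real.cos (titsAngle ξ η) ∂μ

/-- A measure on the Tits boundary is semistable if its slope function is nonnegative. -/
def IsSemistable {X : Type*} [MetricSpace X] (μ : Measure (IdealBoundary X)) : Prop :=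
  ∀ η : IdealBoundary X, 0 ≤ titsSlope μ η

/-- The measure `ν` on `ℤ/n` with `ν(i) = d(x_{i-1}, x_i)` given by an `n`-gon `x : ℤ/n → X`. -/
def sideMeasure {X : Type*} [MetricSpace X] {n : ℕ} [NeZero n] (x : ZMod n → X) :
    Measure (ZMod n) :=
  ∑ i : ZMod n, ENNReal.ofReal (dist (x (i - 1)) (x i)) • Measure.dirac i

/-- `ψ` is a Gauss map of the polygon `x`: a ray from `x_{i-1}` asymptotic to `ψ i` passes
through `x_i`. -/
def IsGaussMap {X : Type*} [MetricSpace X] {n : ℕ} (x : ZMod n → X)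
    (ψ : ZMod n → IdealBoundary X) : Prop :=
  ∀ i : ZMod n, ∃ ρ : GeodesicRay X,
    ρ.toFun 0 = x (i - 1) ∧ ρ.endpoint = ψ i ∧ x i ∈ Set.range ρ.toFun

/-- The slope function of `ψ_* ν` is given by the expected finite sum. -/
theorem titsSlope_map_sideMeasure {X : Type*} [MetricSpace X] {n : ℕ} [NeZero n] (x : ZMod n → X)
    (ψ : ZMod n → IdealBoundary X) (η : IdealBoundary X) :
    titsSlope ((sideMeasure x).map ψ) η =
      -∑ i : ZMod n, dist (x (i - 1)) (x i) * Real.cos (titsAngle (ψ i) η) := by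
  have hψ : Measurable ψ := measurable_from_top
  have hm : ∀ g : IdealBoundary X → ℝ, Measurable g := fun g => measurable_from_top
  unfold titsSlope sideMeasure
  rw [integral_map hψ.aemeasurable (hm _).aestronglyMeasurable, integral_finsetSum_measure]
  · congr 1
    refine Finset.sum_congr rfl fun i _ => ?_
    rw [integral_smul_measure, integral_dirac, ENNReal.toReal_ofReal dist_nonneg, smul_eq_mul]
  · intro i _
    exact (integrable_dirac (by simp)).smul_measure ENNReal.ofReal_ne_top

end

/-!
Let `b` be the Busemann function of a ray `η`, and `ρ` another ray. The Bruhat–Tits inequality for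
the segment from `ρ 0` to `ρ s` and the point `η s` estimates `d(ρ t, η s)² - d(ρ 0, η s)²`; divided
by `s`, it becomes `2 (b(ρ t) - b(ρ 0)) ≤ t (δ² - 2)` as `s → ∞`, where `δ = 2 sin (∠(ρ, η) / 2)` is
the divergence of the rays. So `b(ρ t) - b(ρ 0) ≤ -t cos ∠(ρ, η)`. For the `i`-th side of the
polygon this reads `b(xᵢ) - b(xᵢ₋₁) ≤ -mᵢ cos ∠(ξᵢ, η)`, and around the closed polygon the left-hand
sides sum to `0`.
-/

theorem exists_triangle_of_side_lengths {V : Type*} [NormedAddCommGroup V] [NormedSpace ℝ V]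
    (hV : 1 < Module.rank ℝ V) {a b c : ℝ} (habc : |a - b| ≤ c) (hcab : c ≤ a + b) :
    ∃ x y z : V, dist x y = a ∧ dist x z = b ∧ dist y z = c := by
  obtain ⟨ha, hb⟩ : 0 ≤ a ∧ 0 ≤ b := by
    have h := abs_le.1 (habc.trans hcab)
    constructor <;> linarith
  have : Nontrivial V := rank_pos_iff_nontrivial.1 (zero_lt_one.trans hV)
  obtain ⟨u, hu⟩ := exists_norm_eq V zero_le_one
  have norm_smul_u (r : ℝ) : ‖r • u‖ = |r| := by rw [norm_smul, hu, mul_one, Real.norm_eq_abs]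
  have hnear : dist (a • u) (b • u) = |a - b| := by rw [dist_eq_norm, ← sub_smul, norm_smul_u]
  have hfar : dist (a • u) (-b • u) = a + b := by
    rw [dist_eq_norm, ← sub_smul, norm_smul_u, sub_neg_eq_add, abs_of_nonneg (add_nonneg ha hb)]
  obtain ⟨z, hz, hyz⟩ := (isPreconnected_sphere hV 0 b).intermediate_value
    (mem_sphere_zero_iff_norm.2 ((norm_smul_u b).trans (abs_of_nonneg hb)))
    (mem_sphere_zero_iff_norm.2 ((norm_smul_u (-b)).trans (by rw [abs_neg, abs_of_nonneg hb])))
    (f := dist (a • u)) (by fun_prop) (by rw [hnear, hfar]; exact ⟨habc, hcab⟩)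
  exact ⟨0, a • u, z, by rw [dist_zero_left, norm_smul_u, abs_of_nonneg ha],
    by rw [dist_zero_left, mem_sphere_zero_iff_norm.1 hz], hyz⟩

theorem exists_comparison_triangle {X : Type*} [PseudoMetricSpace X] (x y z : X) :
    ∃ x' y' z' : EuclideanSpace ℝ (Fin 2),
      dist x' y' = dist x y ∧ dist x' z' = dist x z ∧ dist y' z' = dist y z := by
  refine exists_triangle_of_side_lengths ?_ ?_ (dist_triangle_left y z x)
  · exact_mod_cast Module.lt_rank_of_lt_finrank (n := 1) (by simp)
  · simpa only [dist_comm x] using abs_dist_sub_le y z x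

theorem dist_lineMap_lineMap_left {V P : Type*} [SeminormedAddCommGroup V] [NormedSpace ℝ V]
    [PseudoMetricSpace P] [NormedAddTorsor V P] (p q₁ q₂ : P) (r : ℝ) :
    dist (AffineMap.lineMap p q₁ r) (AffineMap.lineMap p q₂ r) = |r| * dist q₁ q₂ := by
  rw [AffineMap.lineMap_apply, AffineMap.lineMap_apply, dist_vadd_cancel_right, dist_smul₀,
    dist_vsub_cancel_right, Real.norm_eq_abs]

theorem dist_lineMap_sq {V P : Type*} [SeminormedAddCommGroup V] [InnerProductSpace ℝ V]
    [PseudoMetricSpace P] [NormedAddTorsor V P] (p q c : P) (r : ℝ) :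
    dist (AffineMap.lineMap p q r) c ^ 2 =
      (1 - r) * dist p c ^ 2 + r * dist q c ^ 2 - r * (1 - r) * dist p q ^ 2 := by
  have hline : AffineMap.lineMap p q r -ᵥ c = (1 - r) • (p -ᵥ c) + r • (q -ᵥ c) := by
    rw [AffineMap.lineMap_apply, vadd_vsub_assoc, ← vsub_sub_vsub_cancel_right q p c]
    module
  rw [dist_eq_norm_vsub V, dist_eq_norm_vsub V p c, dist_eq_norm_vsub V q c,
    dist_eq_norm_vsub V p q, hline, ← vsub_sub_vsub_cancel_right p q c, norm_add_sq_real,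
    norm_sub_sq_real, norm_smul, norm_smul, mul_pow, mul_pow, real_inner_smul_left,
    real_inner_smul_right, Real.norm_eq_abs, Real.norm_eq_abs, sq_abs, sq_abs]
  ring

theorem exists_tendsto_div_atTop_of_convexOn {f : ℝ → ℝ} (hf : ConvexOn ℝ (Set.Ici 0) f) {C : ℝ}
    (hC : ∀ t, 0 ≤ t → f t ≤ f 0 + C * t) : ∃ l, Tendsto (fun t => f t / t) atTop (𝓝 l) := by
  let g : ℝ → ℝ := fun t => slope f 0 (max t 1)
  have hpos (t : ℝ) : 0 < max t 1 := lt_max_of_lt_right one_pos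
  have hmono : Monotone g := fun s t hst =>
    hf.slope_mono Set.self_mem_Ici ⟨(hpos s).le, (hpos s).ne'⟩ ⟨(hpos t).le, (hpos t).ne'⟩
      (max_le_max_right 1 hst)
  have hbdd : BddAbove (Set.range g) := by
    refine ⟨C, Set.forall_mem_range.2 fun t => ?_⟩
    change slope f 0 (max t 1) ≤ C
    rw [slope_def_field, sub_zero, div_le_iff₀ (hpos t), sub_le_iff_le_add']
    exact hC _ (hpos t).le
  have hslope : Tendsto (slope f 0) atTop (𝓝 (⨆ t, g t)) := by
    refine (tendsto_atTop_ciSup hmono hbdd).congr' ?_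
    filter_upwards [eventually_ge_atTop 1] with t ht
    simp only [g, max_eq_left ht]
  refine ⟨_, (hslope.add (tendsto_id.const_div_atTop (f 0))).congr fun t => ?_⟩
  rw [slope_def_field, sub_zero, id, ← add_div, sub_add_cancel]

theorem IsGeodesicSegment.symm {X : Type*} [MetricSpace X] {σ : ℝ → X} {x y : X}
    (h : IsGeodesicSegment σ x y) : IsGeodesicSegment (fun s => σ (1 - s)) y x := by
  obtain ⟨h0, h1, hdist⟩ := h
  refine ⟨by simpa only [sub_zero], by simpa only [sub_self], fun s hs t ht => ?_⟩
  rw [hdist _ (Set.Icc.one_sub_mem hs) _ (Set.Icc.one_sub_mem ht), sub_sub_sub_cancel_left,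
    abs_sub_comm, dist_comm]

namespace GeodesicRay

variable {X : Type*} [MetricSpace X]

theorem dist_apply (ρ : GeodesicRay X) (s t : ℝ≥0) :
    dist (ρ.toFun s) (ρ.toFun t) = |(s : ℝ) - t| := by
  rw [ρ.isometry.dist_eq, NNReal.dist_eq]

theorem dist_zero_apply (ρ : GeodesicRay X) (t : ℝ≥0) : dist (ρ.toFun 0) (ρ.toFun t) = t := by
  rw [dist_apply, NNReal.coe_zero, zero_sub, abs_neg, NNReal.abs_eq]

theorem dist_apply_le (ρ₁ ρ₂ : GeodesicRay X) (t : ℝ≥0) :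
    dist (ρ₁.toFun t) (ρ₂.toFun t) ≤ dist (ρ₁.toFun 0) (ρ₂.toFun 0) + 2 * t := by
  have h := dist_triangle4_left (ρ₁.toFun 0) (ρ₂.toFun 0) (ρ₁.toFun t) (ρ₂.toFun t)
  rw [ρ₁.dist_zero_apply, ρ₂.dist_zero_apply] at h
  linarith

theorem isGeodesicSegment (ρ : GeodesicRay X) (s t : ℝ≥0) :
    IsGeodesicSegment (fun r => ρ.toFun (AffineMap.lineMap (s : ℝ) t r).toNNReal)
      (ρ.toFun s) (ρ.toFun t) := by
  have hnonneg {r : ℝ} (hr : r ∈ Set.Icc (0 : ℝ) 1) : 0 ≤ AffineMap.lineMap (s : ℝ) t r :=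
    (convex_Ici (0 : ℝ)).lineMap_mem s.2 t.2 hr
  refine ⟨by simp, by simp, fun r hr r' hr' => ?_⟩
  rw [dist_apply, dist_apply, Real.coe_toNNReal _ (hnonneg hr), Real.coe_toNNReal _ (hnonneg hr'),
    ← Real.dist_eq, dist_lineMap_lineMap, Real.dist_eq, Real.dist_eq]

/-- The Busemann function of a ray `η`, namely `b(x) = lim_{s → ∞} (d(x, η(s)) - s)`. The limit
exists in every metric space, see `tendsto_busemann`. -/
noncomputable def busemann (η : GeodesicRay X) (x : X) : ℝ :=
  limUnder atTop fun s : ℝ≥0 => dist x (η.toFun s) - s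

theorem tendsto_busemann (η : GeodesicRay X) (x : X) :
    Tendsto (fun s : ℝ≥0 => dist x (η.toFun s) - s) atTop (𝓝 (η.busemann x)) := by
  refine tendsto_nhds_limUnder ⟨_, tendsto_atTop_ciInf (fun s t hst => ?_)
    ⟨-dist x (η.toFun 0), Set.forall_mem_range.2 fun s => ?_⟩⟩
  · have h := dist_triangle x (η.toFun s) (η.toFun t)
    rw [η.dist_apply, abs_sub_comm, abs_of_nonneg (sub_nonneg.2 (NNReal.coe_le_coe.2 hst))] at h
    linarith
  · have h := dist_triangle_left (η.toFun 0) (η.toFun s) x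
    rw [η.dist_zero_apply] at h
    linarith

theorem tendsto_dist_div (η : GeodesicRay X) (x : X) :
    Tendsto (fun s : ℝ≥0 => dist x (η.toFun s) / (s : ℝ)) atTop (𝓝 1) := by
  have h := ((η.tendsto_busemann x).div_atTop
    (NNReal.tendsto_coe_atTop.2 tendsto_id)).add_const 1
  rw [zero_add] at h
  refine h.congr' ?_
  filter_upwards [eventually_ne_atTop 0] with s hs
  rw [id, sub_div, div_self (NNReal.coe_ne_zero.2 hs), sub_add_cancel]

end GeodesicRay

/-- A `CAT(0)` space: a geodesic metric space whose triangles are thinner than their comparison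
triangles in the Euclidean plane. In contrast to `IsHadamardSpace`, it need not be complete. -/
structure IsCATZeroSpace (X : Type*) [MetricSpace X] : Prop where
  geodesic : ∀ x y : X, ∃ σ : ℝ → X, IsGeodesicSegment σ x y
  thin : ∀ (x y z : X) (α β : ℝ → X), IsGeodesicSegment α x y → IsGeodesicSegment β x z →
    ∀ x' y' z' : EuclideanSpace ℝ (Fin 2),
      dist x' y' = dist x y → dist x' z' = dist x z → dist y' z' = dist y z →
      ∀ s ∈ Set.Icc (0 : ℝ) 1, ∀ t ∈ Set.Icc (0 : ℝ) 1,
        dist (α s) (β t) ≤ dist (AffineMap.lineMap x' y' s) (AffineMap.lineMap x' z' t)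

theorem IsHadamardSpace.isCATZeroSpace {X : Type*} [MetricSpace X] (hX : IsHadamardSpace X) :
    IsCATZeroSpace X :=
  ⟨hX.geodesic, hX.thin⟩

namespace IsCATZeroSpace

variable {X : Type*} [MetricSpace X] {x y z w : X} {α β : ℝ → X} {r : ℝ}

theorem bruhat_tits_inequality (hX : IsCATZeroSpace X) (hα : IsGeodesicSegment α x y) (z : X)
    (hr : r ∈ Set.Icc (0 : ℝ) 1) :
    dist (α r) z ^ 2 ≤
      (1 - r) * dist x z ^ 2 + r * dist y z ^ 2 - r * (1 - r) * dist x y ^ 2 := by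
  obtain ⟨β, hβ⟩ := hX.geodesic x z
  obtain ⟨x', y', z', hxy, hxz, hyz⟩ := exists_comparison_triangle x y z
  have hthin : dist (α r) z ≤ dist (AffineMap.lineMap x' y' r) z' := by
    simpa only [hβ.2.1, AffineMap.lineMap_apply_one] using
      hX.thin x y z α β hα hβ x' y' z' hxy hxz hyz r hr 1 unitInterval.one_mem
  rw [← hxy, ← hxz, ← hyz, ← dist_lineMap_sq]
  gcongr

theorem dist_le_mul_of_common_vertex (hX : IsCATZeroSpace X) (hα : IsGeodesicSegment α x y)
    (hβ : IsGeodesicSegment β x z) (hr : r ∈ Set.Icc (0 : ℝ) 1) :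
    dist (α r) (β r) ≤ r * dist y z := by
  obtain ⟨x', y', z', hxy, hxz, hyz⟩ := exists_comparison_triangle x y z
  refine (hX.thin x y z α β hα hβ x' y' z' hxy hxz hyz r hr r hr).trans_eq ?_
  rw [dist_lineMap_lineMap_left, hyz, abs_of_nonneg hr.1]

theorem dist_le_of_isGeodesicSegment (hX : IsCATZeroSpace X) (hα : IsGeodesicSegment α x y)
    (hβ : IsGeodesicSegment β z w) (hr : r ∈ Set.Icc (0 : ℝ) 1) :
    dist (α r) (β r) ≤ (1 - r) * dist x z + r * dist y w := by
  -- The diagonal `σ` cuts the quadrilateral into two triangles.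
  obtain ⟨σ, hσ⟩ := hX.geodesic x w
  have hασ : dist (α r) (σ r) ≤ r * dist y w := hX.dist_le_mul_of_common_vertex hα hσ hr
  have hσβ : dist (σ r) (β r) ≤ (1 - r) * dist x z := by
    simpa only [sub_sub_cancel] using
      hX.dist_le_mul_of_common_vertex hσ.symm hβ.symm (Set.Icc.one_sub_mem hr)
  linarith [dist_triangle (α r) (σ r) (β r)]

theorem convexOn_dist_ray (hX : IsCATZeroSpace X) (ρ₁ ρ₂ : GeodesicRay X) :
    ConvexOn ℝ (Set.Ici 0) fun t : ℝ => dist (ρ₁.toFun t.toNNReal) (ρ₂.toFun t.toNNReal) := by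
  refine ⟨convex_Ici 0, fun s hs t ht a b ha hb hab => ?_⟩
  lift s to ℝ≥0 using hs
  lift t to ℝ≥0 using ht
  obtain rfl : a = 1 - b := eq_sub_of_add_eq hab
  simpa only [AffineMap.lineMap_apply_module, Real.toNNReal_coe, smul_eq_mul] using
    hX.dist_le_of_isGeodesicSegment (ρ₁.isGeodesicSegment s t) (ρ₂.isGeodesicSegment s t)
      ⟨hb, sub_nonneg.1 ha⟩

theorem tendsto_divergence (hX : IsCATZeroSpace X) (ρ₁ ρ₂ : GeodesicRay X) :
    Tendsto (fun t : ℝ≥0 => dist (ρ₁.toFun t) (ρ₂.toFun t) / (t : ℝ)) atTop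
      (𝓝 (ρ₁.divergence ρ₂)) := by
  obtain ⟨l, hl⟩ : ∃ l, Tendsto
      (fun t : ℝ => dist (ρ₁.toFun t.toNNReal) (ρ₂.toFun t.toNNReal) / t) atTop (𝓝 l) := by
    refine exists_tendsto_div_atTop_of_convexOn (hX.convexOn_dist_ray ρ₁ ρ₂) (C := 2) fun t ht => ?_
    lift t to ℝ≥0 using ht
    simpa only [Real.toNNReal_coe, Real.toNNReal_zero] using ρ₁.dist_apply_le ρ₂ t
  refine tendsto_nhds_limUnder ⟨l, ?_⟩
  simpa only [Function.comp_def, id, Real.toNNReal_coe] using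
    hl.comp (NNReal.tendsto_coe_atTop.2 tendsto_id)

theorem divergence_mem_Icc (hX : IsCATZeroSpace X) (ρ₁ ρ₂ : GeodesicRay X) :
    ρ₁.divergence ρ₂ ∈ Set.Icc (0 : ℝ) 2 := by
  have hlim := hX.tendsto_divergence ρ₁ ρ₂
  refine ⟨ge_of_tendsto' hlim fun t => by positivity, ?_⟩
  have hbound : Tendsto (fun t : ℝ≥0 => dist (ρ₁.toFun 0) (ρ₂.toFun 0) / (t : ℝ) + 2) atTop
      (𝓝 (0 + 2)) :=
    (tendsto_const_nhds.div_atTop (NNReal.tendsto_coe_atTop.2 tendsto_id)).add_const 2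
  rw [zero_add] at hbound
  refine le_of_tendsto_of_tendsto hlim hbound ?_
  filter_upwards [eventually_gt_atTop 0] with t ht
  rw [div_le_iff₀ (NNReal.coe_pos.2 ht), add_mul, div_mul_cancel₀ _ (NNReal.coe_pos.2 ht).ne']
  exact ρ₁.dist_apply_le ρ₂ t

theorem cos_titsAngle (hX : IsCATZeroSpace X) (ρ₁ ρ₂ : GeodesicRay X) :
    Real.cos (titsAngle ρ₁.endpoint ρ₂.endpoint) = 1 - ρ₁.divergence ρ₂ ^ 2 / 2 := by
  obtain ⟨hdiv_nonneg, hdiv_le⟩ := hX.divergence_mem_Icc ρ₁ ρ₂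
  change Real.cos (2 * Real.arcsin (ρ₁.divergence ρ₂ / 2)) = _
  rw [Real.cos_two_mul, Real.cos_sq', Real.sin_arcsin (by linarith) (by linarith)]
  ring

theorem dist_ray_sq_le (hX : IsCATZeroSpace X) (ρ : GeodesicRay X) (z : X) {s t : ℝ≥0}
    (hts : t ≤ s) (hs : s ≠ 0) :
    dist (ρ.toFun t) z ^ 2 ≤ dist (ρ.toFun 0) z ^ 2 +
      t / s * (dist (ρ.toFun s) z ^ 2 - dist (ρ.toFun 0) z ^ 2 - s ^ 2) + t ^ 2 := by
  have hs' : (s : ℝ) ≠ 0 := NNReal.coe_ne_zero.2 hs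
  have hr : (t / s : ℝ) ∈ Set.Icc (0 : ℝ) 1 :=
    ⟨by positivity, div_le_one_of_le₀ (NNReal.coe_le_coe.2 hts) s.2⟩
  have h := hX.bruhat_tits_inequality (ρ.isGeodesicSegment 0 s) z hr
  have hparam : (AffineMap.lineMap ((0 : ℝ≥0) : ℝ) s (t / s : ℝ)).toNNReal = t := by
    rw [NNReal.coe_zero, AffineMap.lineMap_apply_module, smul_zero, zero_add, smul_eq_mul,
      div_mul_cancel₀ _ hs', Real.toNNReal_coe]
  rw [hparam, ρ.dist_zero_apply] at h
  refine h.trans_eq ?_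
  field_simp
  ring

theorem busemann_sub_busemann_le (hX : IsCATZeroSpace X) (ρ η : GeodesicRay X) (t : ℝ≥0) :
    η.busemann (ρ.toFun t) - η.busemann (ρ.toFun 0) ≤
      -(t * Real.cos (titsAngle ρ.endpoint η.endpoint)) := by
  let d (u s : ℝ≥0) : ℝ := dist (ρ.toFun u) (η.toFun s)
  have hdiff : Tendsto (fun s => d t s - d 0 s) atTop
      (𝓝 (η.busemann (ρ.toFun t) - η.busemann (ρ.toFun 0))) := by
    refine ((η.tendsto_busemann _).sub (η.tendsto_busemann _)).congr fun s => ?_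
    exact sub_sub_sub_cancel_right _ _ _
  have hleft := hdiff.mul ((η.tendsto_dist_div (ρ.toFun t)).add (η.tendsto_dist_div (ρ.toFun 0)))
  have hright := (((((hX.tendsto_divergence ρ η).pow 2).sub
    ((η.tendsto_dist_div (ρ.toFun 0)).pow 2)).sub_const 1).const_mul (t : ℝ)).add
    ((tendsto_const_nhds (x := (t : ℝ) ^ 2)).div_atTop (NNReal.tendsto_coe_atTop.2 tendsto_id))
  have hle := le_of_tendsto_of_tendsto hleft hright <| by
    filter_upwards [eventually_ge_atTop t, eventually_gt_atTop 0] with s hts hs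
    calc (d t s - d 0 s) * (d t s / s + d 0 s / s)
        = (d t s ^ 2 - d 0 s ^ 2) / s := by ring
      _ ≤ (t / s * (d s s ^ 2 - d 0 s ^ 2 - s ^ 2) + t ^ 2) / s := by
        gcongr
        linarith [hX.dist_ray_sq_le ρ (η.toFun s) hts hs.ne']
      _ = t * ((d s s / s) ^ 2 - (d 0 s / s) ^ 2 - 1) + t ^ 2 / s := by
        field_simp
  rw [hX.cos_titsAngle]
  linarith

theorem isSemistable_map_sideMeasure (hX : IsCATZeroSpace X) {n : ℕ} [NeZero n] {x : ZMod n → X}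
    {ψ : ZMod n → IdealBoundary X} (hψ : IsGaussMap x ψ) :
    IsSemistable ((sideMeasure x).map ψ) := by
  refine Quotient.ind fun η => ?_
  change 0 ≤ titsSlope _ η.endpoint
  have hside (i : ZMod n) : η.busemann (x i) - η.busemann (x (i - 1)) ≤
      -(dist (x (i - 1)) (x i) * Real.cos (titsAngle (ψ i) η.endpoint)) := by
    obtain ⟨ρ, hstart, hend, t, ht⟩ := hψ i
    rw [← hstart, ← hend, ← ht, ρ.dist_zero_apply]
    exact hX.busemann_sub_busemann_le ρ η t
  have hclosed : ∑ i, (η.busemann (x i) - η.busemann (x (i - 1))) = 0 := by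
    rw [Finset.sum_sub_distrib, sub_eq_zero]
    exact (Equiv.sum_comp (Equiv.subRight 1) fun i => η.busemann (x i)).symm
  rw [titsSlope_map_sideMeasure, ← Finset.sum_neg_distrib, ← hclosed]
  exact Finset.sum_le_sum fun i _ => hside i

end IsCATZeroSpace

theorem mainTheorem7_general {X : Type*} [MetricSpace X] (hX : IsCATZeroSpace X)
    (n : ℕ) [NeZero n] (x : ZMod n → X) (ψ : ZMod n → IdealBoundary X) (hψ : IsGaussMap x ψ) :
    IsSemistable ((sideMeasure x).map ψ) ∧
      ∀ η : IdealBoundary X, titsSlope ((sideMeasure x).map ψ) η =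
        -∑ i : ZMod n, dist (x (i - 1)) (x i) * Real.cos (titsAngle (ψ i) η) :=
  ⟨hX.isSemistable_map_sideMeasure hψ, titsSlope_map_sideMeasure x ψ⟩

theorem mainTheorem7 {X : Type*} [MetricSpace X]
    (hX : IsEuclideanBuilding X ∨ IsSymmetricSpaceOfNoncompactType X)
    (n : ℕ) [NeZero n] (x : ZMod n → X) (ψ : ZMod n → IdealBoundary X) (hψ : IsGaussMap x ψ) :
    IsSemistable ((sideMeasure x).map ψ) ∧
      ∀ η : IdealBoundary X, titsSlope ((sideMeasure x).map ψ) η =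
        -∑ i : ZMod n, dist (x (i - 1)) (x i) * Real.cos (titsAngle (ψ i) η) :=
  mainTheorem7_general (hX.elim (fun h => h.1) fun h => h.nonpos_curved).isCATZeroSpace n x ψ hψ
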